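/- Let $\mathfrak g$ be a finite-dimensional simple Lie algebra over $\mathbb C$ with Killing form $\langle\cdot,\cdot\rangle$, $\mathfrak h\subset\mathfrak g$ a Cartan subalgebra, $\Delta_+$ the positive roots for a choice of simple roots, and $E_\alpha\in\mathfrak g_\alpha$ root vectors with $\langle E_\alpha,E_{-\alpha}\rangle=1$. Put $r_0=\sum_{\alpha\in\Delta_+}E_\alpha\wedge E_{-\alpha}$, where $x\wedge y=x\otimes y-y\otimes x$, and let $\Omega\in (S^2\mathfrak g)^{\mathfrak g}$ be the Casimir element of the Killing form. Let $U\subset\mathfrak h^*$ be a connected open subset. A *dynamical $r$-matrix* on $U$ is a holomorphic map $r:U\to\wedge^2\mathfrak g$ such that for all $\lambda\in U$: $[h,r(\lambda)]=0$ for every $h\in\mathfrak h$, and $$\mathrm{Alt}(dr)+\tfrac12[r,r]=[\Omega^{12},\Omega^{23}],\qquad \mathrm{Alt}(dr)=\sum_i\Big(h_i^{(1)}\frac{\partial r^{23}}{\partial\lambda_i}-h_i^{(2)}\frac{\partial r^{13}}{\partial\lambda_i}+h_i^{(3)}\frac{\partial r^{12}}{\partial\lambda_i}\Big),$$ where $[\cdot,\cdot]$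 is the Schouten bracket on $\wedge^*\mathfrak g$, $(h_i)$ is a basis of $\mathfrak h$ and $(\lambda_i)$ are the coordinates on $\mathfrak h^*$ for the dual basis. Let $A=TU\times\mathfrak g$ be the Lie algebroid over $U$ whose anchor $a$ is the projection to $TU$ and whose bracket is $[X+\xi,Y+\eta]=[X,Y]+[\xi,\eta]+L_X\eta-L_Y\xi$ for holomorphic vector fields $X,Y$ and holomorphic functions $\xi,\eta:U\to\mathfrak g$. Regard $r_0$ as a constant section of $\wedge^2A$, write $\Lambda^\#:A^*\to A$, $\langle\eta,\Lambda^\#\xi\rangle=\Lambda(\xi,\eta)$, for $\Lambda\in\Gamma(\wedge^2A)$, and equip $A^*$ with the anchor $a_*=a\circ r_0^\#$ and the bracket $[\xi,\eta]_*=L_{r_0^\#\xi}\eta-L_{r_0^\#\eta}\xi-d(r_0(\xi,\eta))$. This is the coboundary Lie bialgebroid $(A,A^*,r_0)$. A *Dirac structure* of it is a subbundle of $A\oplus A^*$ that is maximal isotropic for $(X_1+\xi_1,X_2+\xi_2)=\frac12(\langle\xi_1,X_2\rangle+\langle\xi_2,X_1\rangle)$ and whose holomorphic sections (over $U$ and over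 each open subset of $U$) are closed under the Courant bracket $$\begin{aligned}[X_1+\xi_1,X_2+\xi_2]=&\;\{[X_1,X_2]+L_{\xi_1}X_2-L_{\xi_2}X_1-\tfrac12d_*(\langle\xi_1,X_2\rangle-\langle\xi_2,X_1\rangle)\}\\&+\{[\xi_1,\xi_2]_*+L_{X_1}\xi_2-L_{X_2}\xi_1+\tfrac12d(\langle\xi_1,X_2\rangle-\langle\xi_2,X_1\rangle)\}.\end{aligned}$$ **Proposition.** Let $\tau$ be a function from $U$ to $\wedge^2\mathfrak g$ such that $r=r_0+\tau$ is a dynamical $r$-matrix on $U$. Regard $\tau$ as a section of $\wedge^2A$, and $U\times\mathfrak h$ as a subbundle of $A$ with conormal bundle $(U\times\mathfrak h)^\perp\subset A^*$. Then the subbundle $$W=\{X+\tau^\#\xi+\xi\;:\;X\in U\times\mathfrak h,\ \xi\in(U\times\mathfrak h)^\perp\}\subset A\oplus A^*$$ defined by the characteristic pair $(U\times\mathfrak h,\tau)$ is a Dirac structure of the Lie bialgebroid $(A,A^*,r_0)$. -/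

import Mathlib

open scoped TensorProduct

noncomputable section

namespace DynDirac

open Module

/-! ### Calculus on finite-dimensional complex vector spaces

A finite-dimensional complex vector space has a unique Hausdorff vector space topology, and
holomorphy and derivatives depend on nothing else. We use the norm obtained from a linear
isomorphism with `ℂⁿ`. -/

section Calculus

/-- The norm on `V` transported from the sup norm of `ℂⁿ` along a basis. -/
abbrev fdNorm (V : Type*) [AddCommGroup V] [Module ℂ V] [FiniteDimensional ℂ V] :
    NormedAddCommGroup V :=
  NormedAddCommGroup.induced V (Fin (finrank ℂ V) → ℂ) (finBasis ℂ V).equivFun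
    (finBasis ℂ V).equivFun.injective

/-- `V` with the norm `fdNorm V` is a normed space. -/
abbrev fdNormedSpace (V : Type*) [AddCommGroup V] [Module ℂ V] [FiniteDimensional ℂ V] :
    letI := fdNorm V
    NormedSpace ℂ V :=
  letI := fdNorm V
  NormedSpace.induced ℂ V (Fin (finrank ℂ V) → ℂ) (finBasis ℂ V).equivFun

variable {V F : Type*} [AddCommGroup V] [Module ℂ V] [FiniteDimensional ℂ V]
  [AddCommGroup F] [Module ℂ F] [FiniteDimensional ℂ F]

/-- `U` is open in the canonical topology of `V`. -/
def IsOpenFD (U : Set V) : Prop :=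
  letI := fdNorm V
  IsOpen U

/-- `U` is connected (and nonempty) in the canonical topology of `V`. -/
def IsConnectedFD (U : Set V) : Prop :=
  letI := fdNorm V
  IsConnected U

/-- `f` is holomorphic on `U` (used for open `U` only). -/
def HolomorphicOn (f : V → F) (U : Set V) : Prop :=
  letI := fdNorm V
  letI := fdNormedSpace V
  letI := fdNorm F
  letI := fdNormedSpace F
  DifferentiableOn ℂ f U

/-- The complex derivative of `f` at `x`. -/
def der (f : V → F) (x : V) : V →ₗ[ℂ] F :=
  letI := fdNorm V
  letI := fdNormedSpace V
  letI := fdNorm F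
  letI := fdNormedSpace F
  (fderiv ℂ f x).toLinearMap

end Calculus

/-! ### Lie algebroid calculus on trivial bundles

Over an open `U ⊆ V` we work with trivial bundles `U × F`. Their sections are functions `V → F`
that are holomorphic on `U`; every operation below is local, so its value at a point of `U` only
depends on the sections near that point. The dual bundle is `U × F*`. -/

section Algebroid

variable {V F : Type*} [AddCommGroup V] [Module ℂ V] [FiniteDimensional ℂ V]
  [AddCommGroup F] [Module ℂ F] [FiniteDimensional ℂ F]

variable (V F) in
/-- The operations of a Lie algebroid on the trivial bundle with fibre `F`: the anchor, a bundle
map to the tangent bundle (with fibre `V`), and the bracket of sections. -/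
structure AlgebroidOps where
  anchor : V → F →ₗ[ℂ] V
  bracket : (V → F) → (V → F) → V → F

/-- The differential of a function: `⟨d f, X⟩ = a(X) f`. -/
def AlgebroidOps.d (A : AlgebroidOps V F) (f : V → ℂ) : V → Dual ℂ F :=
  fun x => der f x ∘ₗ A.anchor x

/-- The Lie derivative of a section of the dual bundle:
`⟨L_X ξ, Y⟩ = a(X)⟨ξ, Y⟩ - ⟨ξ, [X, Y]⟩`. The right hand side is function-linear in `Y`, so
`L_X ξ` is the covector given by its values on a frame of constant sections `Y`. -/
def AlgebroidOps.lieDer (A : AlgebroidOps V F) (X : V → F) (ξ : V → Dual ℂ F) : V → Dual ℂ F :=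
  fun x => (finBasis ℂ F).constr ℂ fun i =>
    der (fun y => ξ y (finBasis ℂ F i)) x (A.anchor x (X x))
      - ξ x (A.bracket X (fun _ => finBasis ℂ F i) x)

/-- `Λ^# : F* → F`, `⟨η, Λ^# ξ⟩ = Λ(ξ, η)`; on `x ⊗ y` it is `ξ ↦ ξ(x) y`. Elements of `⋀² F` are
skew-symmetric elements of `F ⊗ F`, with `x ∧ y = x ⊗ y - y ⊗ x`. -/
def sharp : F ⊗[ℂ] F →ₗ[ℂ] Dual ℂ F →ₗ[ℂ] F :=
  TensorProduct.lift <| LinearMap.mk₂ ℂ (fun x y => (Dual.eval ℂ F x).smulRight y)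
    (fun x x' y => by ext; simp [add_smul])
    (fun c x y => by ext; simp [mul_smul])
    (fun x y y' => by ext; simp)
    (fun c x y => by ext ξ; exact smul_comm (ξ x) c y)

/-- The operations on the dual bundle induced by a bivector field `Λ ∈ Γ(⋀² A)`: the anchor is
`a ∘ Λ^#` and the bracket is `[ξ, η]_Λ = L_{Λ^# ξ} η - L_{Λ^# η} ξ - d(Λ(ξ, η))`. -/
def AlgebroidOps.coboundaryDual (A : AlgebroidOps V F) (Λ : V → F ⊗[ℂ] F) :
    AlgebroidOps V (Dual ℂ F) where
  anchor x := A.anchor x ∘ₗ sharp (Λ x)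
  bracket ξ η x :=
    A.lieDer (fun y => sharp (Λ y) (ξ y)) η x - A.lieDer (fun y => sharp (Λ y) (η y)) ξ x
      - A.d (fun y => η y (sharp (Λ y) (ξ y))) x

/-- `d_* f` as a section of `A`, through `A ≅ A**`. -/
def AlgebroidOps.dStar (B : AlgebroidOps V (Dual ℂ F)) (f : V → ℂ) : V → F :=
  fun x => (evalEquiv ℂ F).symm (B.d f x)

/-- `L_ξ X` as a section of `A`, through `A ≅ A**`. -/
def AlgebroidOps.lieDerStar (B : AlgebroidOps V (Dual ℂ F)) (ξ : V → Dual ℂ F) (X : V → F) :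
    V → F :=
  fun x => (evalEquiv ℂ F).symm (B.lieDer ξ (fun y => evalEquiv ℂ F (X y)) x)

/-- The Courant bracket of sections of the double `A ⊕ A*` of `(A, A*)`. -/
def courantBracket (A : AlgebroidOps V F) (B : AlgebroidOps V (Dual ℂ F))
    (e₁ e₂ : V → F × Dual ℂ F) : V → F × Dual ℂ F :=
  let X₁ : V → F := fun x => (e₁ x).1
  let ξ₁ : V → Dual ℂ F := fun x => (e₁ x).2
  let X₂ : V → F := fun x => (e₂ x).1
  let ξ₂ : V → Dual ℂ F := fun x => (e₂ x).2
  let f : V → ℂ := fun x => ξ₁ x (X₂ x) - ξ₂ x (X₁ x)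
  fun x =>
    (A.bracket X₁ X₂ x + B.lieDerStar ξ₁ X₂ x - B.lieDerStar ξ₂ X₁ x
        - (1 / 2 : ℂ) • B.dStar f x,
      B.bracket ξ₁ ξ₂ x + A.lieDer X₁ ξ₂ x - A.lieDer X₂ ξ₁ x
        + (1 / 2 : ℂ) • A.d f x)

/-- The symmetric bilinear form on the fibre of `A ⊕ A*`. -/
def pairing (e₁ e₂ : F × Dual ℂ F) : ℂ :=
  (1 / 2 : ℂ) * (e₁.2 e₂.1 + e₂.2 e₁.1)

/-- A subspace of the fibre on which the form vanishes identically. -/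
def IsIsotropic (S : Submodule ℂ (F × Dual ℂ F)) : Prop :=
  ∀ u ∈ S, ∀ v ∈ S, pairing u v = 0

/-- A family of subspaces of a fibre `G` is a holomorphic subbundle of `U × G`: locally it has a
holomorphic frame. -/
def IsSubbundle {G : Type*} [AddCommGroup G] [Module ℂ G] [FiniteDimensional ℂ G]
    (U : Set V) (W : V → Submodule ℂ G) : Prop :=
  ∀ x ∈ U, ∃ U' : Set V, IsOpenFD U' ∧ x ∈ U' ∧ U' ⊆ U ∧
    ∃ (k : ℕ) (e : Fin k → V → G), (∀ i, HolomorphicOn (e i) U') ∧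
      ∀ y ∈ U', LinearIndependent ℂ (fun i => e i y) ∧
        Submodule.span ℂ (Set.range fun i => e i y) = W y

/-- `e` is a holomorphic section over `U` of the family of subspaces `W`. -/
def IsSection {G : Type*} [AddCommGroup G] [Module ℂ G] [FiniteDimensional ℂ G]
    (U : Set V) (W : V → Submodule ℂ G) (e : V → G) : Prop :=
  HolomorphicOn e U ∧ ∀ x ∈ U, e x ∈ W x

/-- `W` is a Dirac structure of `(A, A*)` over `U`: a maximal isotropic subbundle of `A ⊕ A*` whose
sections (over `U` and over all its open subsets) are closed under the Courant bracket. -/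
structure IsDirac (A : AlgebroidOps V F) (B : AlgebroidOps V (Dual ℂ F)) (U : Set V)
    (W : V → Submodule ℂ (F × Dual ℂ F)) : Prop where
  subbundle : IsSubbundle U W
  maximal_isotropic : ∀ x ∈ U, Maximal IsIsotropic (W x)
  integrable : ∀ U' : Set V, IsOpenFD U' → U' ⊆ U → ∀ e₁ e₂ : V → F × Dual ℂ F,
    IsSection U' W e₁ → IsSection U' W e₂ → ∀ x ∈ U', courantBracket A B e₁ e₂ x ∈ W x

/-- The subbundle `{X + H^# ξ + ξ | X ∈ D, ξ ∈ D^⊥}` of `A ⊕ A*` defined by the characteristic pair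
`(D, H)`. -/
def characteristicPair (D : V → Submodule ℂ F) (H : V → F ⊗[ℂ] F) :
    V → Submodule ℂ (F × Dual ℂ F) :=
  fun x => ((D x).prod (D x).dualAnnihilator).map
    ((LinearMap.fst ℂ F (Dual ℂ F) + sharp (H x) ∘ₗ LinearMap.snd ℂ F (Dual ℂ F)).prod
      (LinearMap.snd ℂ F (Dual ℂ F)))

end Algebroid

/-! ### The gauge Lie algebroid `TU × 𝔤` -/

section Gauge

variable (V L : Type*) [AddCommGroup V] [Module ℂ V] [FiniteDimensional ℂ V]
  [LieRing L] [LieAlgebra ℂ L] [FiniteDimensional ℂ L]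

/-- The Lie algebroid `TU × L`: the anchor is the projection to `TU`, and
`[X + ξ, Y + η] = [X, Y] + [ξ, η] + L_X η - L_Y ξ`. -/
def gaugeAlgebroid : AlgebroidOps V (V × L) where
  anchor _ := LinearMap.fst ℂ V L
  bracket s t x := der t x (s x).1 - der s x (t x).1 + (0, ⁅(s x).2, (t x).2⁆)

variable {L}

/-- An `L ⊗ L`-valued function regarded as a section of `A ⊗ A`, for `A = TU × L`. -/
def gaugeSection (t : V → L ⊗[ℂ] L) : V → (V × L) ⊗[ℂ] (V × L) :=
  fun x => TensorProduct.map (LinearMap.inr ℂ V L) (LinearMap.inr ℂ V L) (t x)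

end Gauge

/-! ### Dynamical r-matrices -/

section RMatrix

variable {L : Type*} [LieRing L] [LieAlgebra ℂ L]

/-- `x ⊗ y ⊗ z ↦ y ⊗ z ⊗ x`. -/
def cyc : L ⊗[ℂ] (L ⊗[ℂ] L) →ₗ[ℂ] L ⊗[ℂ] (L ⊗[ℂ] L) :=
  (TensorProduct.assoc ℂ L L L).toLinearMap ∘ₗ (TensorProduct.comm ℂ L (L ⊗[ℂ] L)).toLinearMap

/-- `x ⊗ y ⊗ z ↦ x ∧ y ∧ z`, the signed sum over all six permutations. -/
def wedge₃ : L ⊗[ℂ] (L ⊗[ℂ] L) →ₗ[ℂ] L ⊗[ℂ] (L ⊗[ℂ] L) :=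
  (LinearMap.id + cyc + cyc ∘ₗ cyc) ∘ₗ
    (LinearMap.id - TensorProduct.map LinearMap.id (TensorProduct.comm ℂ L L).toLinearMap)

/-- The Lie bracket as a linear map `L ⊗ L → L`. -/
def brak : L ⊗[ℂ] L →ₗ[ℂ] L := (LieModule.toModuleHom ℂ L L : L ⊗[ℂ] L →ₗ[ℂ] L)

/-- The Schouten bracket `⋀² L × ⋀² L → ⋀³ L`, that is
`[x ∧ y, z ∧ w] = [x,z] ∧ y ∧ w - [x,w] ∧ y ∧ z - [y,z] ∧ x ∧ w + [y,w] ∧ x ∧ z`.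
With `x ∧ y = x ⊗ y - y ⊗ x` it is the bilinear map with
`(x ⊗ y, z ⊗ w) ↦ [x, z] ∧ y ∧ w`, restricted to skew-symmetric tensors. -/
def schouten (r s : L ⊗[ℂ] L) : L ⊗[ℂ] (L ⊗[ℂ] L) :=
  wedge₃ (TensorProduct.map brak LinearMap.id
    (TensorProduct.tensorTensorTensorComm ℂ L L L L (r ⊗ₜ[ℂ] s)))

/-- `[r¹², s²³]`: `(x ⊗ y, z ⊗ w) ↦ x ⊗ [y, z] ⊗ w`. -/
def brak₁₂₂₃ (r s : L ⊗[ℂ] L) : L ⊗[ℂ] (L ⊗[ℂ] L) :=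
  TensorProduct.map LinearMap.id
    (TensorProduct.map brak LinearMap.id ∘ₗ (TensorProduct.assoc ℂ L L L).symm.toLinearMap)
    (TensorProduct.assoc ℂ L L (L ⊗[ℂ] L) (r ⊗ₜ[ℂ] s))

variable [FiniteDimensional ℂ L]

variable (L) in
/-- The Casimir element `Ω ∈ (S² L)^L` of the Killing form: `∑ eᵢ ⊗ eⁱ` for dual bases. -/
def casimir [LieAlgebra.IsKilling ℂ L] : L ⊗[ℂ] L :=
  ∑ i, finBasis ℂ L i ⊗ₜ[ℂ]
    LinearMap.BilinForm.dualBasis (killingForm ℂ L)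
      (LieAlgebra.IsKilling.killingForm_nondegenerate ℂ L) (finBasis ℂ L) i

variable (H : LieSubalgebra ℂ L)

/-- `Alt(dr) = ∑ᵢ (hᵢ⁽¹⁾ ∂r²³/∂λᵢ - hᵢ⁽²⁾ ∂r¹³/∂λᵢ + hᵢ⁽³⁾ ∂r¹²/∂λᵢ)` for a function `r` on `H*`,
where `hᵢ` is a basis of `H` and `λᵢ` are the coordinates on `H*` with respect to the dual basis
(the sum does not depend on the basis). -/
def altD (r : Dual ℂ H → L ⊗[ℂ] L) (x : Dual ℂ H) : L ⊗[ℂ] (L ⊗[ℂ] L) :=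
  ∑ i, (let t : L ⊗[ℂ] (L ⊗[ℂ] L) :=
          (finBasis ℂ H i : L) ⊗ₜ[ℂ] der r x ((finBasis ℂ H).dualBasis i)
        t - TensorProduct.leftComm ℂ L L L t + cyc t)

/-- `r : U → ⋀² L` is a (skew-symmetric, holomorphic) dynamical r-matrix on `U ⊆ H*` with coupling
constant `ε`: it has zero weight and satisfies the modified classical dynamical Yang-Baxter equation
`Alt(dr) + ½ [r, r] = (ε² / 4) [Ω¹², Ω²³]`. -/
structure IsDynamicalRMatrix [LieAlgebra.IsKilling ℂ L] (ε : ℂ) (U : Set (Dual ℂ H))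
    (r : Dual ℂ H → L ⊗[ℂ] L) : Prop where
  holomorphic : HolomorphicOn r U
  skew : ∀ x ∈ U, TensorProduct.comm ℂ L L (r x) = -r x
  zero_weight : ∀ x ∈ U, ∀ h : H, ⁅(h : L), r x⁆ = 0
  mcdybe : ∀ x ∈ U, altD H r x + (1 / 2 : ℂ) • schouten (r x) (r x) =
    (ε ^ 2 / 4) • brak₁₂₂₃ (casimir L) (casimir L)

variable [LieAlgebra.IsKilling ℂ L] [H.IsCartanSubalgebra]

/-- Root vectors `E_α ∈ L_α`, for all roots `α`, with `⟨E_α, E_{-α}⟩ = 1` for the Killing form. -/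
def IsRootVectors (E : LieModule.Weight ℂ H L → L) : Prop :=
  ∀ α : LieModule.Weight ℂ H L, α.IsNonZero →
    E α ∈ LieAlgebra.rootSpace H α ∧ killingForm ℂ L (E α) (E (-α)) = 1

open Classical in
/-- The standard r-matrix `r₀ = ∑_{α > 0} E_α ∧ E_{-α}`, positivity being that of the base `b`. -/
def standardRMatrix (b : (LieAlgebra.IsKilling.rootSystem H).Base)
    (E : LieModule.Weight ℂ H L → L) : L ⊗[ℂ] L :=
  ∑ α : H.root with b.IsPos α,
    (E α.1 ⊗ₜ[ℂ] E (-α.1) - E (-α.1) ⊗ₜ[ℂ] E α.1)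

end RMatrix

end DynDirac

end

/-! Subbundle and maximal isotropy are linear algebra, so the content is closure under the Courant
bracket, and this reduces to an identity at each point. Sections of `W` have vanishing
`TU`-component, and `a_* = a ∘ r₀^#` is zero because `r₀` is vertical. Hence all derivatives
disappear from the `A`-component of the bracket and from the restriction to `𝔤` of its
`A*`-component, and membership in `W` depends on nothing else.

Take sections with values `h + τ^#ξ` and `k + τ^#η` in `𝔤`, where `h, k ∈ 𝔥` and `ξ, η` vanish on
`𝔥`. The covector part of the bracket is then `ξ ∘ ad (k + r^#η) - η ∘ ad (h + r^#ξ)`, which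
vanishes on `𝔥` since `r` is skew and `𝔥`-invariant (`apply_lie_sharp_of_invariant`). The vector
part minus `τ^#` of the covector part equals `Q(r) - Q(r₀)`, with `Q` the Yang-Baxter defect
evaluated at `ξ, η`; invariance removes `h` and `k` (`yangBaxterDefect_eq_of_invariant`).

It remains to see that `Q(r) - Q(r₀) ∈ 𝔥` (`yangBaxterDefect_sub_mem`). Contract the dynamical
equation with `ξ, η` in the outer two slots. The Schouten term gives `-Q(r)`; the Casimir term gives
`[y, z]`, where `y, z` are Killing dual to `ξ, η`; and `Alt(dr)` gives an element of `𝔥`. Finally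
`Q(r₀) = -[y, z]` (`yangBaxterDefect_standardRMatrix`), because `r₀` acts on root spaces as minus
the sign of the root. -/

namespace DynDirac

open Module

/-! ### Two-tensors as maps from the dual. -/

section Tensor

variable {F G : Type*} [AddCommGroup F] [Module ℂ F] [AddCommGroup G] [Module ℂ G]

@[simp]
lemma sharp_tmul (x y : F) (ξ : Dual ℂ F) : sharp (x ⊗ₜ[ℂ] y) ξ = ξ x • y := rfl

lemma sharp_map (f : F →ₗ[ℂ] G) (t : F ⊗[ℂ] F) (ξ : Dual ℂ G) :
    sharp (TensorProduct.map f f t) ξ = f (sharp t (ξ ∘ₗ f)) := by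
  induction t with
  | zero => simp
  | tmul x y => simp
  | add s t hs ht => simp [hs, ht]

lemma apply_sharp_comm (t : F ⊗[ℂ] F) (ξ η : Dual ℂ F) :
    η (sharp (TensorProduct.comm ℂ F F t) ξ) = ξ (sharp t η) := by
  induction t with
  | zero => simp
  | tmul x y => simp [mul_comm]
  | add s t hs ht => simp [hs, ht]

lemma apply_sharp_of_skew {t : F ⊗[ℂ] F} (ht : TensorProduct.comm ℂ F F t = -t)
    (ξ η : Dual ℂ F) : η (sharp t ξ) = -ξ (sharp t η) := by
  rw [← apply_sharp_comm t ξ η, ht]; simp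

end Tensor

/-! ### Contracting three-tensors in the outer slots. -/

section Contraction

variable {L : Type*} [LieRing L] [LieAlgebra ℂ L]

/-- The contraction `x ⊗ y ⊗ z ↦ ξ(x) η(z) y`. -/
noncomputable def outerContraction (ξ η : Dual ℂ L) : L ⊗[ℂ] (L ⊗[ℂ] L) →ₗ[ℂ] L :=
  (TensorProduct.lid ℂ L).toLinearMap ∘ₗ
    TensorProduct.map ξ ((TensorProduct.rid ℂ L).toLinearMap ∘ₗ TensorProduct.map LinearMap.id η)

@[simp]
lemma outerContraction_tmul (ξ η : Dual ℂ L) (x y z : L) :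
    outerContraction ξ η (x ⊗ₜ[ℂ] (y ⊗ₜ[ℂ] z)) = ξ x • η z • y := rfl

lemma sharp_lie (h : L) (t : L ⊗[ℂ] L) (ξ : Dual ℂ L) :
    sharp ⁅h, t⁆ ξ = ⁅h, sharp t ξ⁆ + sharp t (ξ ∘ₗ LieAlgebra.ad ℂ L h) := by
  induction t with
  | zero => simp
  | tmul x y => simp [TensorProduct.LieModule.lie_tmul_right, add_comm]
  | add s t hs ht => simp only [lie_add, map_add, LinearMap.add_apply, hs, ht]; abel

/-- Skewness is not assumed, so that bilinearity reduces the identity to pure tensors. The six terms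
come from the six permutations in `wedge₃`; flips appear because `schouten` brackets first factors
while `sharp` returns the second. -/
lemma outerContraction_schouten_aux (r s : L ⊗[ℂ] L) (ξ η : Dual ℂ L) :
    outerContraction ξ η (schouten r s) =
      - sharp r (ξ ∘ₗ LieAlgebra.ad ℂ L (sharp (TensorProduct.comm ℂ L L s) η))
      + sharp s (η ∘ₗ LieAlgebra.ad ℂ L (sharp (TensorProduct.comm ℂ L L r) ξ))
      - sharp s (ξ ∘ₗ LieAlgebra.ad ℂ L (sharp (TensorProduct.comm ℂ L L r) η))
      + sharp r (η ∘ₗ LieAlgebra.ad ℂ L (sharp (TensorProduct.comm ℂ L L s) ξ))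
      + ⁅sharp (TensorProduct.comm ℂ L L r) η, sharp (TensorProduct.comm ℂ L L s) ξ⁆
      - ⁅sharp (TensorProduct.comm ℂ L L r) ξ, sharp (TensorProduct.comm ℂ L L s) η⁆ := by
  induction r with
  | zero => simp [schouten]
  | add r r' h h' =>
    have : schouten (r + r') s = schouten r s + schouten r' s := by
      simp [schouten, TensorProduct.add_tmul]
    rw [this, map_add, h, h']
    simp only [map_add, LinearMap.add_apply, add_lie, LinearMap.comp_add]
    abel
  | tmul x y =>
    induction s with
    | zero => simp [schouten]
    | add s s' h h' =>
      have : schouten (x ⊗ₜ[ℂ] y) (s + s') = schouten (x ⊗ₜ[ℂ] y) s + schouten (x ⊗ₜ[ℂ] y) s' := by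
        simp [schouten, TensorProduct.tmul_add]
      rw [this, map_add, h, h']
      simp only [map_add, LinearMap.add_apply, lie_add, LinearMap.comp_add]
      abel
    | tmul z w =>
      have e : brak (x ⊗ₜ[ℂ] z) = ⁅x, z⁆ := rfl
      have e' : ⁅z, x⁆ = -⁅x, z⁆ := (lie_skew z x).symm
      simp [schouten, wedge₃, cyc, e, e', -lie_skew]
      module

/-- The defect of the classical Yang-Baxter equation for `r`, as a map `L* × L* → L`. -/
noncomputable def yangBaxterDefect (r : L ⊗[ℂ] L) (ξ η : Dual ℂ L) : L :=
  ⁅sharp r ξ, sharp r η⁆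
    - sharp r (ξ ∘ₗ LieAlgebra.ad ℂ L (sharp r η)
      - η ∘ₗ LieAlgebra.ad ℂ L (sharp r ξ))

/-- For skew `r` the six terms coincide in pairs, which the factor `1 / 2` absorbs. -/
lemma outerContraction_schouten {r : L ⊗[ℂ] L} (hr : TensorProduct.comm ℂ L L r = -r)
    (ξ η : Dual ℂ L) :
    outerContraction ξ η ((1 / 2 : ℂ) • schouten r r) = -yangBaxterDefect r ξ η := by
  rw [map_smul, outerContraction_schouten_aux, hr, yangBaxterDefect]
  have e : ⁅sharp r η, sharp r ξ⁆ = -⁅sharp r ξ, sharp r η⁆ := (lie_skew _ _).symm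
  simp only [map_neg, LinearMap.neg_apply, LinearMap.comp_neg, map_sub, lie_neg, neg_lie, e]
  module

lemma killingForm_comp_ad (y z : L) :
    killingForm ℂ L y ∘ₗ LieAlgebra.ad ℂ L z = killingForm ℂ L ⁅y, z⁆ := by
  ext w
  simp [LieModule.traceForm_apply_lie_apply]

/-- This is why the outer slots are contracted: terms with `hᵢ` in slot 1 or 3 are killed by `ξ` or
`η`, and the remaining one leaves `hᵢ` in the middle. -/
lemma outerContraction_altD [FiniteDimensional ℂ L] (H : LieSubalgebra ℂ L)
    (r : Dual ℂ H → L ⊗[ℂ] L) (x : Dual ℂ H) {ξ η : Dual ℂ L} (hξ : ∀ h ∈ H, ξ h = 0)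
    (hη : ∀ h ∈ H, η h = 0) : outerContraction ξ η (altD H r x) ∈ H := by
  unfold altD
  rw [map_sum]
  refine sum_mem fun i _ => ?_
  generalize der r x ((finBasis ℂ H).dualBasis i) = t
  generalize finBasis ℂ H i = h
  induction t with
  | zero => simp
  | tmul y z =>
    simp only [map_add, map_sub, TensorProduct.leftComm_tmul, outerContraction_tmul, cyc,
      LinearMap.comp_apply, LinearEquiv.coe_coe, TensorProduct.comm_tmul,
      TensorProduct.assoc_tmul, hξ h h.2, hη h h.2, zero_smul, smul_zero, zero_sub, add_zero]
    exact neg_mem (SMulMemClass.smul_mem _ (SMulMemClass.smul_mem _ h.2))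
  | add s t hs ht =>
    convert add_mem hs ht using 1
    simp only [TensorProduct.tmul_add, map_add, map_sub]
    abel

end Contraction

/-! ### The Casimir term of the Yang-Baxter equation. -/

section Killing

variable {L : Type*} [LieRing L] [LieAlgebra ℂ L] [FiniteDimensional ℂ L]
  [LieAlgebra.IsKilling ℂ L]

/-- Contracting either copy of the Casimir element is expansion in dual bases: the first returns
`y`, the second `z`, and the middle slot brackets them. -/
lemma outerContraction_casimir (y z : L) :
    outerContraction (killingForm ℂ L y) (killingForm ℂ L z)
      (brak₁₂₂₃ (casimir L) (casimir L)) = ⁅y, z⁆ := by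
  set b := finBasis ℂ L
  set c := LinearMap.BilinForm.dualBasis (killingForm ℂ L)
    (LieAlgebra.IsKilling.killingForm_nondegenerate ℂ L) b with hc
  have sym (u v : L) : killingForm ℂ L u v = killingForm ℂ L v u :=
    LieModule.traceForm_comm ℂ L L u v
  have hcas : casimir L = ∑ i, b i ⊗ₜ[ℂ] c i := rfl
  have hy : ∑ i, killingForm ℂ L y (b i) • c i = y := by
    conv_rhs => rw [← c.sum_repr y]
    simp only [hc, LinearMap.BilinForm.dualBasis_repr_apply]
  have hz : ∑ i, killingForm ℂ L z (c i) • b i = z := by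
    conv_rhs => rw [← b.sum_repr z]
    refine Finset.sum_congr rfl fun i _ => ?_
    congr 1
    conv_lhs => rw [← b.sum_repr z]
    simp only [map_sum, LinearMap.sum_apply, map_smul, LinearMap.smul_apply, smul_eq_mul]
    rw [Finset.sum_eq_single i]
    · rw [sym, hc, LinearMap.BilinForm.apply_dualBasis_left]; simp
    · intro j _ hj
      rw [sym, hc, LinearMap.BilinForm.apply_dualBasis_left]; simp [hj]
    · simp
  have hbr (x y z w : L) : brak₁₂₂₃ (x ⊗ₜ[ℂ] y) (z ⊗ₜ[ℂ] w) = x ⊗ₜ[ℂ] (⁅y, z⁆ ⊗ₜ[ℂ] w) := rfl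
  have key : brak₁₂₂₃ (casimir L) (casimir L) =
      ∑ i, ∑ j, b i ⊗ₜ[ℂ] (⁅c i, b j⁆ ⊗ₜ[ℂ] c j) := by
    simp only [← hbr]
    simp only [hcas, brak₁₂₂₃, TensorProduct.sum_tmul, TensorProduct.tmul_sum, map_sum]
    exact Finset.sum_comm
  rw [key]
  conv_rhs => rw [← hy, ← hz]
  simp only [map_sum, outerContraction_tmul, sum_lie, lie_sum, smul_lie, lie_smul,
    Finset.smul_sum]
  rw [Finset.sum_comm]
  simp only [smul_comm (killingForm ℂ L y _)]

end Killing

/-! ### The standard r-matrix on root spaces. -/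

section Standard

open LieModule LieAlgebra

lemma _root_.LieSubalgebra.mem_root {L : Type*} [LieRing L] [LieAlgebra ℂ L]
    [FiniteDimensional ℂ L] {H : LieSubalgebra ℂ L} [H.IsCartanSubalgebra]
    (χ : Weight ℂ H L) : χ ∈ H.root ↔ χ.IsNonZero := by
  simp

variable {L : Type*} [LieRing L] [LieAlgebra ℂ L] [FiniteDimensional ℂ L]
  [LieAlgebra.IsKilling ℂ L] {H : LieSubalgebra ℂ L} [H.IsCartanSubalgebra]

open Classical in
/-- The height of a weight of the adjoint representation, which is zero for the zero weight. -/
noncomputable def weightHeight (b : (IsKilling.rootSystem H).Base) (χ : Weight ℂ H L) : ℤ :=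
  if h : χ ∈ H.root then b.height ⟨χ, h⟩ else 0

lemma weightHeight_root (b : (IsKilling.rootSystem H).Base) (α : H.root) :
    weightHeight b α.1 = b.height α := by
  simp only [weightHeight, α.2, dif_pos]

lemma weightHeight_of_isZero (b : (IsKilling.rootSystem H).Base) {χ : Weight ℂ H L}
    (h : χ.IsZero) : weightHeight b χ = 0 := by
  rw [weightHeight, dif_neg]
  rw [LieSubalgebra.mem_root]
  exact fun h' => h' h

lemma weightHeight_ne_zero (b : (IsKilling.rootSystem H).Base) {χ : Weight ℂ H L}
    (h : χ.IsNonZero) : weightHeight b χ ≠ 0 := by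
  rw [weightHeight_root b ⟨χ, (LieSubalgebra.mem_root χ).2 h⟩]
  exact b.height_ne_zero _

/-- Zero weights are included because brackets involve `𝔥`, and opposite root vectors bracket into
it. -/
lemma weightHeight_add (b : (IsKilling.rootSystem H).Base) {χ χ' ψ : Weight ℂ H L}
    (h : (ψ : H → ℂ) = χ + χ') : weightHeight b ψ = weightHeight b χ + weightHeight b χ' := by
  by_cases h₁ : χ.IsZero
  · have : ψ = χ' := by ext x; rw [h, h₁, zero_add]
    rw [this, weightHeight_of_isZero b h₁, zero_add]
  by_cases h₂ : χ'.IsZero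
  · have : ψ = χ := by ext x; rw [h, h₂, add_zero]
    rw [this, weightHeight_of_isZero b h₂, add_zero]
  have m₁ := (LieSubalgebra.mem_root χ).2 h₁
  have m₂ := (LieSubalgebra.mem_root χ').2 h₂
  rw [weightHeight_root b ⟨χ, m₁⟩, weightHeight_root b ⟨χ', m₂⟩]
  by_cases h₃ : ψ.IsZero
  · rw [weightHeight_of_isZero b h₃]
    have hneg : (IsKilling.rootSystem H).root ⟨χ', m₂⟩ = -(IsKilling.rootSystem H).root ⟨χ, m₁⟩ := by
      ext x
      have := congrFun h x
      rw [h₃] at this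
      simp only [Pi.zero_apply, Pi.add_apply] at this
      simp only [IsKilling.rootSystem_root_apply, LinearMap.neg_apply, Weight.toLinear_apply]
      linear_combination -this
    let := (IsKilling.rootSystem H).indexNeg
    have e : (⟨χ', m₂⟩ : H.root) = -⟨χ, m₁⟩ := by
      apply (IsKilling.rootSystem H).root.injective
      rw [hneg, RootPairing.indexNeg_neg, RootPairing.root_reflectionPerm,
        RootPairing.reflection_apply_self]
    rw [e, b.height_reflectionPerm_self]; ring
  · have m₃ := (LieSubalgebra.mem_root ψ).2 h₃
    rw [weightHeight_root b ⟨ψ, m₃⟩]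
    apply b.height_add
    ext x
    simpa using congrFun h x

lemma weightHeight_neg (b : (IsKilling.rootSystem H).Base) (χ : Weight ℂ H L) :
    weightHeight b (-χ) = -weightHeight b χ := by
  by_cases h : χ.IsZero
  · rw [weightHeight_of_isZero b h, weightHeight_of_isZero b h.neg, neg_zero]
  · have : Nontrivial L := by
      obtain ⟨x, -, hx⟩ := χ.exists_ne_zero
      exact ⟨x, 0, hx⟩
    have : weightHeight b (0 : Weight ℂ H L) = weightHeight b χ + weightHeight b (-χ) :=
      weightHeight_add b (by simp)
    rw [weightHeight_of_isZero b Weight.isZero_zero] at this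
    linarith

lemma killingForm_smul_rootVector {E : Weight ℂ H L → L} (hE : IsRootVectors H E)
    {χ : Weight ℂ H L} (hχ : χ.IsNonZero) {y : L} (hy : y ∈ rootSpace H χ) :
    killingForm ℂ L y (E (-χ)) • E χ = y := by
  obtain ⟨hm, h1⟩ := hE χ hχ
  have hne : (⟨E χ, hm⟩ : rootSpace H χ) ≠ 0 := by
    intro h
    have : E χ = 0 := congrArg Subtype.val h
    simp [this] at h1
  obtain ⟨c, hc⟩ := exists_smul_eq_of_finrank_eq_one (IsKilling.finrank_rootSpace_eq_one χ hχ) hne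
    ⟨y, hy⟩
  have hc' : c • E χ = y := congrArg Subtype.val hc
  rw [← hc', map_smul, LinearMap.smul_apply, h1, smul_eq_mul, mul_one]

lemma killingForm_rootVector_eq_zero {E : Weight ℂ H L → L} (hE : IsRootVectors H E)
    {χ α : Weight ℂ H L} (hα : α.IsNonZero) {y : L} (hy : y ∈ rootSpace H χ) (h : α ≠ -χ) :
    killingForm ℂ L y (E α) = 0 := by
  refine killingForm_apply_eq_zero_of_mem_rootSpace_of_add_ne_zero ℂ L H hy (hE α hα).1 ?_
  contrapose! h
  ext x
  have := congrFun h x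
  simp only [Pi.add_apply, Pi.zero_apply] at this
  simp only [Weight.coe_neg, Pi.neg_apply]
  linear_combination this

/-- Only root vectors of weight `-χ` pair nontrivially with `y`, so at most the summand of the
positive root among `±χ` survives. The sign of the height also gives the value 0 on `𝔥`. -/
lemma sharp_standardRMatrix (b : (IsKilling.rootSystem H).Base) {E : Weight ℂ H L → L}
    (hE : IsRootVectors H E) (χ : Weight ℂ H L) {y : L} (hy : y ∈ rootSpace H χ) :
    sharp (standardRMatrix H b E) (killingForm ℂ L y) =
      -((weightHeight b χ).sign : ℂ) • y := by
  classical
  have hsum : sharp (standardRMatrix H b E) (killingForm ℂ L y) =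
      ∑ α : H.root with b.IsPos α, (killingForm ℂ L y (E α.1) • E (-α.1)
        - killingForm ℂ L y (E (-α.1)) • E α.1) := by
    simp only [standardRMatrix, map_sum, map_sub, LinearMap.sum_apply, LinearMap.sub_apply,
      sharp_tmul]
  have hpos (α : H.root) : b.IsPos α ↔ 0 < weightHeight b α.1 := by
    rw [weightHeight_root]; rfl
  have hnz (α : H.root) : α.1.IsNonZero := H.isNonZero_coe_root α
  rw [hsum]
  rcases lt_trichotomy (weightHeight b χ) 0 with h | h | h
  · have hχ : χ.IsNonZero := fun h' => by rw [weightHeight_of_isZero b h'] at h; exact h.false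
    rw [Finset.sum_eq_single ⟨-χ, (LieSubalgebra.mem_root _).2 hχ.neg⟩]
    · have : killingForm ℂ L y (E (- -χ)) = 0 := by
        rw [neg_neg]
        refine killingForm_rootVector_eq_zero hE hχ hy fun e => ?_
        have := weightHeight_neg b χ
        rw [← e] at this; omega
      rw [this, neg_neg, killingForm_smul_rootVector hE hχ hy, Int.sign_eq_neg_one_of_neg h]
      simp
    · intro α hα hne
      rw [Finset.mem_filter, hpos] at hα
      rw [killingForm_rootVector_eq_zero hE (hnz α) hy (fun e => hne (Subtype.ext e)),
        killingForm_rootVector_eq_zero hE (hnz α).neg hy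
          (fun e => by rw [neg_inj] at e; rw [e] at hα; omega)]
      simp
    · intro h'
      rw [Finset.mem_filter, hpos, weightHeight_neg] at h'
      exact absurd ⟨Finset.mem_univ _, by omega⟩ h'
  · rw [h, Finset.sum_eq_zero]
    · simp
    · intro α hα
      rw [Finset.mem_filter, hpos] at hα
      rw [killingForm_rootVector_eq_zero hE (hnz α) hy
          (fun e => by rw [e, weightHeight_neg] at hα; omega),
        killingForm_rootVector_eq_zero hE (hnz α).neg hy
          (fun e => by rw [neg_inj] at e; rw [e] at hα; omega)]
      simp
  · have hχ : χ.IsNonZero := fun h' => by rw [weightHeight_of_isZero b h'] at h; exact h.false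
    rw [Finset.sum_eq_single ⟨χ, (LieSubalgebra.mem_root _).2 hχ⟩]
    · rw [killingForm_rootVector_eq_zero hE hχ hy (fun e => ?_),
        killingForm_smul_rootVector hE hχ hy, Int.sign_eq_one_of_pos h]
      · simp
      · have := weightHeight_neg b χ
        rw [← e] at this; omega
    · intro α hα hne
      rw [Finset.mem_filter, hpos] at hα
      rw [killingForm_rootVector_eq_zero hE (hnz α) hy
          (fun e => by rw [e, weightHeight_neg] at hα; omega),
        killingForm_rootVector_eq_zero hE (hnz α).neg hy
          (fun e => hne (Subtype.ext (neg_inj.1 e)))]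
      simp
    · intro h'
      rw [Finset.mem_filter, hpos] at h'
      exact absurd ⟨Finset.mem_univ _, h⟩ h'

lemma comm_standardRMatrix (b : (IsKilling.rootSystem H).Base) (E : Weight ℂ H L → L) :
    TensorProduct.comm ℂ L L (standardRMatrix H b E) = -standardRMatrix H b E := by
  simp [standardRMatrix, map_sum]

/-- Both sides are bilinear, so weight vectors suffice; there the operator is scalar and the
equation becomes an identity among signs of heights. -/
lemma yangBaxterDefect_standardRMatrix (b : (IsKilling.rootSystem H).Base)
    {E : Weight ℂ H L → L} (hE : IsRootVectors H E) (y z : L) :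
    yangBaxterDefect (standardRMatrix H b E) (killingForm ℂ L y) (killingForm ℂ L z) =
      -⁅y, z⁆ := by
  set R : L →ₗ[ℂ] L := sharp (standardRMatrix H b E) ∘ₗ killingForm ℂ L with hR
  have hdef (y z : L) :
      yangBaxterDefect (standardRMatrix H b E) (killingForm ℂ L y) (killingForm ℂ L z) =
        ⁅R y, R z⁆ - (R ⁅y, R z⁆ - R ⁅z, R y⁆) := by
    simp only [yangBaxterDefect, killingForm_comp_ad, hR, LinearMap.comp_apply, map_sub]
  rw [hdef]
  have hRw (χ : Weight ℂ H L) {y : L} (hy : y ∈ rootSpace H χ) :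
      R y = -((weightHeight b χ).sign : ℂ) • y := sharp_standardRMatrix b hE χ hy
  have htop (y : L) : y ∈ ⨆ χ : Weight ℂ H L, (rootSpace H χ).toSubmodule := by
    rw [← LieSubmodule.iSup_toSubmodule, LieModule.iSup_genWeightSpace_eq_top']
    trivial
  induction htop y using Submodule.iSup_induction' with
  | zero => simp
  | add u v _ _ hu hv =>
    simp only [map_add, add_lie, lie_add]
    linear_combination (norm := module) hu + hv
  | mem χ y hy =>
    induction htop z using Submodule.iSup_induction' with
    | zero => simp
    | add u v _ _ hu hv =>
      simp only [map_add, add_lie, lie_add]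
      linear_combination (norm := module) hu + hv
    | mem χ' z hz =>
      have hyz : ⁅z, y⁆ = -⁅y, z⁆ := (lie_skew z y).symm
      rw [hRw χ hy, hRw χ' hz]
      simp only [smul_lie, lie_smul, map_smul, hyz, map_neg]
      by_cases h0 : ⁅y, z⁆ = 0
      · simp [h0]
      have hmem : ⁅y, z⁆ ∈ rootSpace H ((χ : H → ℂ) + χ') :=
        lie_mem_genWeightSpace_of_mem_genWeightSpace hy hz
      have hne : rootSpace H ((χ : H → ℂ) + χ') ≠ ⊥ := by
        intro h; rw [h] at hmem; exact h0 (by simpa using hmem)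
      let ψ : Weight ℂ H L := ⟨(χ : H → ℂ) + χ', hne⟩
      rw [hRw ψ (y := ⁅y, z⁆) hmem]
      have hadd : weightHeight b ψ = weightHeight b χ + weightHeight b χ' :=
        weightHeight_add b rfl
      -- The sign identity fails for two zero heights; then `y` and `z` lie in the abelian `𝔥` and
      -- their bracket vanishes.
      have hor : weightHeight b χ ≠ 0 ∨ weightHeight b χ' ≠ 0 := by
        by_contra! hcon
        have h₁ : χ.IsZero := by
          by_contra h; exact weightHeight_ne_zero b h hcon.1
        have h₂ : χ'.IsZero := by
          by_contra h; exact weightHeight_ne_zero b h hcon.2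
        rw [h₁, LieSubmodule.mem_toSubmodule, rootSpace_zero_eq, LieSubalgebra.mem_toLieSubmodule] at hy
        rw [h₂, LieSubmodule.mem_toSubmodule, rootSpace_zero_eq, LieSubalgebra.mem_toLieSubmodule] at hz
        exact h0 (congrArg Subtype.val (trivial_lie_zero H H ⟨y, hy⟩ ⟨z, hz⟩))
      have key : (weightHeight b χ).sign * (weightHeight b χ').sign
          - ((weightHeight b χ).sign + (weightHeight b χ').sign) * (weightHeight b ψ).sign
          = -1 := by
        rw [hadd]
        generalize weightHeight b χ = m at hor
        generalize weightHeight b χ' = n at hor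
        rcases lt_trichotomy m 0 with hm | hm | hm <;> rcases lt_trichotomy n 0 with hn | hn | hn
        · simp [Int.sign_eq_neg_one_of_neg, hm, hn, add_neg hm hn]
        · simp [Int.sign_eq_neg_one_of_neg, hm, hn]
        · rw [Int.sign_eq_neg_one_of_neg hm, Int.sign_eq_one_of_pos hn]; simp
        · simp [Int.sign_eq_neg_one_of_neg, hm, hn]
        · omega
        · simp [Int.sign_eq_one_of_pos, hm, hn]
        · rw [Int.sign_eq_one_of_pos hm, Int.sign_eq_neg_one_of_neg hn]; simp
        · simp [Int.sign_eq_one_of_pos, hm, hn]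
        · simp [Int.sign_eq_one_of_pos, hm, hn, add_pos hm hn]
      have key' := congrArg (Int.cast : ℤ → ℂ) key
      push_cast at key'
      linear_combination (norm := module) key' • (⁅y, z⁆ : L)

end Standard

/-! ### Characteristic pairs: maximal isotropy and holomorphic frames. -/

section CharacteristicPair

variable {V F : Type*} [AddCommGroup V] [Module ℂ V] [FiniteDimensional ℂ V]
  [AddCommGroup F] [Module ℂ F] [FiniteDimensional ℂ F]

omit [AddCommGroup V] [Module ℂ V] [FiniteDimensional ℂ V] [FiniteDimensional ℂ F] in
lemma mem_characteristicPair {D : V → Submodule ℂ F} {H : V → F ⊗[ℂ] F} {x : V}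
    {u : F × Dual ℂ F} : u ∈ characteristicPair D H x ↔
      u.2 ∈ (D x).dualAnnihilator ∧ u.1 - sharp (H x) u.2 ∈ D x := by
  simp only [characteristicPair, Submodule.mem_map, Submodule.mem_prod]
  constructor
  · rintro ⟨w, ⟨h₁, h₂⟩, rfl⟩
    exact ⟨h₂, by simpa using h₁⟩
  · rintro ⟨h₁, h₂⟩
    exact ⟨(u.1 - sharp (H x) u.2, u.2), ⟨h₂, h₁⟩, by ext1 <;> simp⟩

lemma maximal_isIsotropic_characteristicPair {D : V → Submodule ℂ F} {H : V → F ⊗[ℂ] F} {x : V}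
    (hH : TensorProduct.comm ℂ F F (H x) = -H x) :
    Maximal IsIsotropic (characteristicPair D H x) := by
  refine ⟨fun u hu v hv => ?_, fun S hS hle u hu => ?_⟩
  · rw [mem_characteristicPair] at hu hv
    have h₁ := (Submodule.mem_dualAnnihilator _).1 hu.1 _ hv.2
    have h₂ := (Submodule.mem_dualAnnihilator _).1 hv.1 _ hu.2
    have h₃ := apply_sharp_of_skew hH u.2 v.2
    rw [map_sub] at h₁ h₂
    rw [pairing]
    linear_combination (1 / 2 : ℂ) * (h₁ + h₂ + h₃)
  · have key (w : F × Dual ℂ F) (hw : w ∈ characteristicPair D H x) : u.2 w.1 + w.2 u.1 = 0 := by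
      have := hS u hu w (hle hw)
      rw [pairing] at this
      linear_combination 2 * this
    have hann : u.2 ∈ (D x).dualAnnihilator := by
      rw [Submodule.mem_dualAnnihilator]
      intro X hX
      simpa using key (X, 0) (mem_characteristicPair.2 ⟨zero_mem _, by simpa using hX⟩)
    refine mem_characteristicPair.2 ⟨hann, ?_⟩
    -- Membership in `D` is tested on its annihilator, by pairing `u` with the elements `H^#ξ + ξ`
    -- of the subbundle.
    rw [← Subspace.dualAnnihilator_dualCoannihilator_eq (W := D x),
      Submodule.mem_dualCoannihilator]
    intro ξ hξ
    have h := key (sharp (H x) ξ, ξ) (mem_characteristicPair.2 ⟨hξ, by simp⟩)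
    have h' := apply_sharp_of_skew hH ξ u.2
    rw [map_sub]
    simp only at h
    linear_combination h - h'

lemma holomorphicOn_const (c : F) (U : Set V) :
    HolomorphicOn (fun _ => c) U := by
  let _ := fdNorm V
  let _ := fdNormedSpace V
  let _ := fdNorm F
  let _ := fdNormedSpace F
  exact differentiableOn_const c

lemma HolomorphicOn.add {f g : V → F} {U : Set V} (hf : HolomorphicOn f U)
    (hg : HolomorphicOn g U) : HolomorphicOn (fun x => f x + g x) U := by
  let _ := fdNorm V
  let _ := fdNormedSpace V
  let _ := fdNorm F
  let _ := fdNormedSpace F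
  exact DifferentiableOn.fun_add hf hg

lemma HolomorphicOn.linearMap_comp {G : Type*} [AddCommGroup G] [Module ℂ G]
    [FiniteDimensional ℂ G] {f : V → F} {U : Set V} (hf : HolomorphicOn f U) (φ : F →ₗ[ℂ] G) :
    HolomorphicOn (fun x => φ (f x)) U := by
  let _ := fdNorm V
  let _ := fdNormedSpace V
  let _ := fdNorm F
  let _ := fdNormedSpace F
  let _ := fdNorm G
  let _ := fdNormedSpace G
  exact (LinearMap.toContinuousLinearMap φ).differentiable.comp_differentiableOn hf

lemma isSubbundle_characteristicPair (D : Submodule ℂ F) {H : V → F ⊗[ℂ] F} {U : Set V}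
    (hU : IsOpenFD U) (hH : HolomorphicOn H U) :
    IsSubbundle U (characteristicPair (fun _ => D) H) := by
  intro x hx
  have hol (w : F × Dual ℂ F) : HolomorphicOn (fun y =>
      (LinearMap.fst ℂ F (Dual ℂ F) + sharp (H y) ∘ₗ LinearMap.snd ℂ F (Dual ℂ F)).prod
        (LinearMap.snd ℂ F (Dual ℂ F)) w) U := by
    have := (holomorphicOn_const w U).add
      (hH.linearMap_comp (LinearMap.inl ℂ F (Dual ℂ F) ∘ₗ LinearMap.applyₗ w.2 ∘ₗ sharp))
    refine (congrArg (HolomorphicOn · U) (funext fun y => ?_)).mp this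
    ext1 <;> simp
  -- As `D` is constant, a basis of `D × D^⊥` transported by the injective map `X + ξ ↦ X + H^#ξ +
  -- ξ` is a frame over all of `U`.
  refine ⟨U, hU, hx, subset_rfl, finrank ℂ (D.prod D.dualAnnihilator),
    fun i y => (LinearMap.fst ℂ F (Dual ℂ F) + sharp (H y) ∘ₗ LinearMap.snd ℂ F (Dual ℂ F)).prod
      (LinearMap.snd ℂ F (Dual ℂ F)) (finBasis ℂ (D.prod D.dualAnnihilator) i : F × Dual ℂ F),
    fun i => hol _, fun y _ => ⟨?_, ?_⟩⟩
  · refine LinearIndependent.map' (LinearIndependent.map'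
      (finBasis ℂ (D.prod D.dualAnnihilator)).linearIndependent (Submodule.subtype _)
      (Submodule.ker_subtype _)) _ ?_
    rw [LinearMap.ker_eq_bot']
    rintro ⟨X, ξ⟩ h
    rw [Prod.ext_iff] at h
    obtain ⟨h₁, h₂⟩ := h
    change ξ = 0 at h₂
    subst h₂
    simpa using h₁
  · rw [characteristicPair]
    conv_rhs => rw [← Submodule.range_subtype (D.prod D.dualAnnihilator), LinearMap.range_eq_map,
      ← (finBasis ℂ (D.prod D.dualAnnihilator)).span_eq, Submodule.map_span, Submodule.map_span,
      ← Set.range_comp, ← Set.range_comp]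
    rfl

end CharacteristicPair

/-! ### Lie derivatives along vertical sections. -/

section GaugeCalculus

variable {V L : Type*} [AddCommGroup V] [Module ℂ V] [FiniteDimensional ℂ V]
  [LieRing L] [LieAlgebra ℂ L] [FiniteDimensional ℂ L]

omit [FiniteDimensional ℂ V] [FiniteDimensional ℂ L] in
lemma sharp_gaugeSection (t : V → L ⊗[ℂ] L) (x : V) (ξ : Dual ℂ (V × L)) :
    sharp (gaugeSection V t x) ξ = (0, sharp (t x) (ξ ∘ₗ LinearMap.inr ℂ V L)) := by
  rw [gaugeSection, sharp_map, LinearMap.inr_apply]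

omit [FiniteDimensional ℂ V] [FiniteDimensional ℂ L] in
lemma comm_gaugeSection {t : V → L ⊗[ℂ] L} {x : V}
    (ht : TensorProduct.comm ℂ L L (t x) = -t x) :
    TensorProduct.comm ℂ _ _ (gaugeSection V t x) = -gaugeSection V t x := by
  rw [gaugeSection, ← map_neg, ← ht]
  generalize t x = s
  induction s with
  | zero => simp
  | tmul x y => simp
  | add s t hs ht => simp only [map_add, hs, ht]

/-- With zero anchor at `x`, no derivative of `ξ` enters, and the derivative of `X` is seen only by
the tangent part of `Y`. -/
lemma gaugeAlgebroid_lieDer_apply {X : V → V × L} {x : V} (hX : (X x).1 = 0)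
    (ξ : V → Dual ℂ (V × L)) (Y : V × L) :
    (gaugeAlgebroid V L).lieDer X ξ x Y =
      ξ x (der X x Y.1) - ξ x (0, ⁅(X x).2, Y.2⁆) := by
  have : (gaugeAlgebroid V L).lieDer X ξ x = ξ x ∘ₗ (der X x ∘ₗ LinearMap.fst ℂ V L -
      LinearMap.inr ℂ V L ∘ₗ LieAlgebra.ad ℂ L (X x).2 ∘ₗ LinearMap.snd ℂ V L) := by
    refine (finBasis ℂ (V × L)).ext fun i => ?_
    rw [AlgebroidOps.lieDer, Basis.constr_basis]
    simp [gaugeAlgebroid, hX]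
    ring
  rw [this]
  simp

variable (t : L ⊗[ℂ] L)

lemma coboundaryDual_anchor (x : V) :
    ((gaugeAlgebroid V L).coboundaryDual (gaugeSection V fun _ => t)).anchor x = 0 := by
  ext ξ : 1
  simp [AlgebroidOps.coboundaryDual, gaugeAlgebroid, sharp_gaugeSection]

lemma coboundaryDual_bracket_apply (ξ η : V → Dual ℂ (V × L)) (x : V) {Y : V × L}
    (hY : Y.1 = 0) :
    ((gaugeAlgebroid V L).coboundaryDual (gaugeSection V fun _ => t)).bracket ξ η x Y =
      ξ x (0, ⁅sharp t (η x ∘ₗ LinearMap.inr ℂ V L), Y.2⁆)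
        - η x (0, ⁅sharp t (ξ x ∘ₗ LinearMap.inr ℂ V L), Y.2⁆) := by
  simp only [AlgebroidOps.coboundaryDual, LinearMap.sub_apply]
  rw [gaugeAlgebroid_lieDer_apply (by simp [sharp_gaugeSection]),
    gaugeAlgebroid_lieDer_apply (by simp [sharp_gaugeSection])]
  simp [AlgebroidOps.d, gaugeAlgebroid, hY, sharp_gaugeSection]
  ring

lemma coboundaryDual_dStar (f : V → ℂ) (x : V) :
    ((gaugeAlgebroid V L).coboundaryDual (gaugeSection V fun _ => t)).dStar f x = 0 := by
  simp [AlgebroidOps.dStar, AlgebroidOps.d, coboundaryDual_anchor]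

variable {t}

/-- The zero dual anchor leaves only the dual bracket; skewness of `t` then moves `t^#` off the test
covector. -/
lemma coboundaryDual_lieDerStar (ht : TensorProduct.comm ℂ L L t = -t)
    (ξ : V → Dual ℂ (V × L)) {X : V → V × L} {x : V} (hX : (X x).1 = 0) :
    ((gaugeAlgebroid V L).coboundaryDual (gaugeSection V fun _ => t)).lieDerStar ξ X x =
      (0, ⁅sharp t (ξ x ∘ₗ LinearMap.inr ℂ V L), (X x).2⁆
        - sharp t ((ξ x ∘ₗ LinearMap.inr ℂ V L) ∘ₗ LieAlgebra.ad ℂ L (X x).2)) := by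
  rw [AlgebroidOps.lieDerStar, LinearEquiv.symm_apply_eq]
  refine (finBasis ℂ (Dual ℂ (V × L))).ext fun i => ?_
  rw [AlgebroidOps.lieDer, Basis.constr_basis, coboundaryDual_anchor]
  generalize finBasis ℂ (Dual ℂ (V × L)) i = φ
  rw [LinearMap.zero_apply, map_zero, evalEquiv_apply, evalEquiv_apply,
    Dual.eval_apply, Dual.eval_apply,
    coboundaryDual_bracket_apply t _ _ _ hX]
  have h := apply_sharp_of_skew ht (φ ∘ₗ LinearMap.inr ℂ V L)
    ((ξ x ∘ₗ LinearMap.inr ℂ V L) ∘ₗ LieAlgebra.ad ℂ L (X x).2)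
  have e : ⁅sharp t (φ ∘ₗ LinearMap.inr ℂ V L), (X x).2⁆ =
    -⁅(X x).2, sharp t (φ ∘ₗ LinearMap.inr ℂ V L)⁆ := (lie_skew _ _).symm
  have hneg (ψ : Dual ℂ (V × L)) (a : L) : ψ (0, -a) = -ψ (0, a) := by
    rw [← map_neg]; simp
  have hsub (ψ : Dual ℂ (V × L)) (a b : L) : ψ (0, a - b) = ψ (0, a) - ψ (0, b) := by
    rw [← map_sub]; simp
  simp only [LinearMap.comp_apply, LinearMap.inr_apply, LieAlgebra.ad_apply] at h
  rw [e, hneg, hsub]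
  linear_combination h

end GaugeCalculus

/-! ### The Courant bracket without derivatives. -/

section CourantBracket

variable {V L : Type*} [AddCommGroup V] [Module ℂ V] [FiniteDimensional ℂ V]
  [LieRing L] [LieAlgebra ℂ L] [FiniteDimensional ℂ L] {t : L ⊗[ℂ] L}
  {e₁ e₂ : V → (V × L) × Dual ℂ (V × L)} {x : V}

lemma courantBracket_gauge_fst (ht : TensorProduct.comm ℂ L L t = -t)
    (h₁ : (e₁ x).1.1 = 0) (h₂ : (e₂ x).1.1 = 0) :
    (courantBracket (gaugeAlgebroid V L)
      ((gaugeAlgebroid V L).coboundaryDual (gaugeSection V fun _ => t)) e₁ e₂ x).1 =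
      (0, ⁅(e₁ x).1.2, (e₂ x).1.2⁆
        + (⁅sharp t ((e₁ x).2 ∘ₗ LinearMap.inr ℂ V L), (e₂ x).1.2⁆
          - sharp t (((e₁ x).2 ∘ₗ LinearMap.inr ℂ V L) ∘ₗ LieAlgebra.ad ℂ L (e₂ x).1.2))
        - (⁅sharp t ((e₂ x).2 ∘ₗ LinearMap.inr ℂ V L), (e₁ x).1.2⁆
          - sharp t (((e₂ x).2 ∘ₗ LinearMap.inr ℂ V L) ∘ₗ LieAlgebra.ad ℂ L (e₁ x).1.2))) := by
  simp only [courantBracket]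
  rw [coboundaryDual_lieDerStar ht _ h₂, coboundaryDual_lieDerStar ht _ h₁, coboundaryDual_dStar]
  simp [gaugeAlgebroid, h₁, h₂]

/-- Restriction to `L` discards the tangent directions, the only ones in which derivatives of the
sections survive. -/
lemma courantBracket_gauge_snd (h₁ : (e₁ x).1.1 = 0) (h₂ : (e₂ x).1.1 = 0) :
    (courantBracket (gaugeAlgebroid V L)
      ((gaugeAlgebroid V L).coboundaryDual (gaugeSection V fun _ => t)) e₁ e₂ x).2 ∘ₗ
        LinearMap.inr ℂ V L =
      ((e₁ x).2 ∘ₗ LinearMap.inr ℂ V L) ∘ₗ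
          LieAlgebra.ad ℂ L ((e₂ x).1.2 + sharp t ((e₂ x).2 ∘ₗ LinearMap.inr ℂ V L))
        - ((e₂ x).2 ∘ₗ LinearMap.inr ℂ V L) ∘ₗ
          LieAlgebra.ad ℂ L ((e₁ x).1.2 + sharp t ((e₁ x).2 ∘ₗ LinearMap.inr ℂ V L)) := by
  ext b
  simp only [courantBracket, LinearMap.comp_apply, LinearMap.add_apply, LinearMap.sub_apply,
    LinearMap.smul_apply, LinearMap.inr_apply, LieAlgebra.ad_apply, map_add]
  rw [coboundaryDual_bracket_apply t _ _ _ rfl, gaugeAlgebroid_lieDer_apply h₁,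
    gaugeAlgebroid_lieDer_apply h₂]
  simp only [AlgebroidOps.d, gaugeAlgebroid, LinearMap.comp_apply, LinearMap.fst_apply, map_zero,
    smul_zero]
  ring

end CourantBracket

/-! ### Consequences of invariance and the dynamical equation at a point. -/

section Pointwise

variable {L : Type*} [LieRing L] [LieAlgebra ℂ L]

lemma lie_sharp_of_lie_eq_zero {h : L} {r : L ⊗[ℂ] L} (hr : ⁅h, r⁆ = 0) (ξ : Dual ℂ L) :
    sharp r (ξ ∘ₗ LieAlgebra.ad ℂ L h) = -⁅h, sharp r ξ⁆ := by
  have := sharp_lie h r ξ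
  rw [hr, map_zero, LinearMap.zero_apply] at this
  exact (neg_eq_of_add_eq_zero_right this.symm).symm

/-- Replacing `r^# ξ` and `r^# η` by their translates under an abelian subalgebra that fixes `r`
does not change the defect of the classical Yang-Baxter equation. -/
lemma yangBaxterDefect_eq_of_invariant {r : L ⊗[ℂ] L} {h k : L} (hh : ⁅h, r⁆ = 0)
    (hk : ⁅k, r⁆ = 0) (hhk : ⁅h, k⁆ = 0) (ξ η : Dual ℂ L) :
    ⁅h + sharp r ξ, k + sharp r η⁆
      - sharp r (ξ ∘ₗ LieAlgebra.ad ℂ L (k + sharp r η) - η ∘ₗ LieAlgebra.ad ℂ L (h + sharp r ξ))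
      = yangBaxterDefect r ξ η := by
  have e : ⁅sharp r ξ, k⁆ = -⁅k, sharp r ξ⁆ := (lie_skew _ _).symm
  simp only [yangBaxterDefect, map_add, map_sub, LinearMap.comp_add, lie_sharp_of_lie_eq_zero hh,
    lie_sharp_of_lie_eq_zero hk, add_lie, lie_add, hhk, e]
  abel

/-- Used with `h ∈ 𝔥` to see that the covector part of the Courant bracket annihilates `𝔥`. -/
lemma apply_lie_sharp_of_invariant {r : L ⊗[ℂ] L} (hr : TensorProduct.comm ℂ L L r = -r)
    {h : L} (hh : ⁅h, r⁆ = 0) (ξ η : Dual ℂ L) :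
    ξ ⁅sharp r η, h⁆ = η ⁅sharp r ξ, h⁆ := by
  have h₁ := apply_sharp_of_skew hr (η ∘ₗ LieAlgebra.ad ℂ L h) ξ
  rw [lie_sharp_of_lie_eq_zero hh, ← lie_skew (sharp r η) h, LinearMap.comp_apply,
    LieAlgebra.ad_apply] at *
  rw [h₁, ← lie_skew h, map_neg, neg_neg]

variable [FiniteDimensional ℂ L] [LieAlgebra.IsKilling ℂ L] {H : LieSubalgebra ℂ L}
  [H.IsCartanSubalgebra]

lemma exists_killingForm_eq (ξ : Dual ℂ L) : ∃ y, killingForm ℂ L y = ξ := by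
  have hB := LieAlgebra.IsKilling.killingForm_nondegenerate ℂ L
  refine ⟨(LinearMap.BilinForm.toDual (killingForm ℂ L) hB).symm ξ, ?_⟩
  ext z
  rw [← LinearMap.BilinForm.toDual_def hB, LinearEquiv.apply_symm_apply]

/-- Coupling constant 2 gives `ε² / 4 = 1`, so the Casimir contribution cancels exactly against the
defect of the standard r-matrix, leaving the contraction of `Alt(dr)`. -/
lemma yangBaxterDefect_sub_mem (b : (LieAlgebra.IsKilling.rootSystem H).Base)
    {E : LieModule.Weight ℂ H L → L} (hE : IsRootVectors H E) {U : Set (Dual ℂ H)}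
    {r : Dual ℂ H → L ⊗[ℂ] L} (hr : IsDynamicalRMatrix H 2 U r) {x : Dual ℂ H} (hx : x ∈ U)
    {ξ η : Dual ℂ L} (hξ : ∀ h ∈ H, ξ h = 0) (hη : ∀ h ∈ H, η h = 0) :
    yangBaxterDefect (r x) ξ η - yangBaxterDefect (standardRMatrix H b E) ξ η ∈ H := by
  obtain ⟨y, hy⟩ := exists_killingForm_eq ξ
  obtain ⟨z, hz⟩ := exists_killingForm_eq η
  have h := congrArg (outerContraction ξ η) (hr.mcdybe x hx)
  rw [map_add, outerContraction_schouten (hr.skew x hx), map_smul, ← hy, ← hz,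
    outerContraction_casimir, hy, hz] at h
  have h' := yangBaxterDefect_standardRMatrix b hE y z
  rw [hy, hz] at h'
  have e : yangBaxterDefect (r x) ξ η - yangBaxterDefect (standardRMatrix H b E) ξ η =
      outerContraction ξ η (altD H r x) := by
    rw [h']
    linear_combination (norm := module) -h
  rw [e]
  exact outerContraction_altD H r x hξ hη

end Pointwise

/-! ### Membership in `W`, and the proposition. -/

section Main

variable {V L : Type*} [AddCommGroup V] [Module ℂ V] [FiniteDimensional ℂ V]
  [LieRing L] [LieAlgebra ℂ L] [FiniteDimensional ℂ L]

/-- The covector enters only through its restriction to `L`, so its `TU`-component never has to be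
computed. -/
lemma mem_characteristicPair_gauge {H : LieSubalgebra ℂ L} {τ : V → L ⊗[ℂ] L} {x : V}
    {u : (V × L) × Dual ℂ (V × L)} :
    u ∈ characteristicPair (fun _ => (⊥ : Submodule ℂ V).prod H.toSubmodule) (gaugeSection V τ) x ↔
      (∀ h ∈ H, (u.2 ∘ₗ LinearMap.inr ℂ V L) h = 0) ∧ u.1.1 = 0 ∧
        u.1.2 - sharp (τ x) (u.2 ∘ₗ LinearMap.inr ℂ V L) ∈ H := by
  rw [mem_characteristicPair, sharp_gaugeSection, Submodule.mem_prod]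
  simp only [Prod.fst_sub, Prod.snd_sub, sub_zero, Submodule.mem_bot,
    LieSubalgebra.mem_toSubmodule]
  refine and_congr_left fun _ => ?_
  rw [Submodule.mem_dualAnnihilator]
  constructor
  · intro h k hk
    exact h (0, k) ⟨zero_mem _, hk⟩
  · rintro h ⟨v, k⟩ ⟨hv, hk⟩
    have : v = 0 := hv
    subst this
    exact h k hk

end Main

end DynDirac

open DynDirac in
theorem proposition5p3 {𝔤 : Type*} [LieRing 𝔤] [LieAlgebra ℂ 𝔤] [FiniteDimensional ℂ 𝔤]
    [LieAlgebra.IsSimple ℂ 𝔤] (𝔥 : LieSubalgebra ℂ 𝔤) [𝔥.IsCartanSubalgebra]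
    (b : (LieAlgebra.IsKilling.rootSystem 𝔥).Base)
    (E : LieModule.Weight ℂ 𝔥 𝔤 → 𝔤) (hE : IsRootVectors 𝔥 E)
    (U : Set (Module.Dual ℂ 𝔥)) (hU : IsOpenFD U) (hUc : IsConnectedFD U)
    (τ : Module.Dual ℂ 𝔥 → 𝔤 ⊗[ℂ] 𝔤)
    (hr : IsDynamicalRMatrix 𝔥 2 U (fun x => standardRMatrix 𝔥 b E + τ x)) :
    IsDirac (gaugeAlgebroid (Module.Dual ℂ 𝔥) 𝔤)
      ((gaugeAlgebroid (Module.Dual ℂ 𝔥) 𝔤).coboundaryDual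
        (gaugeSection (Module.Dual ℂ 𝔥) (fun _ => standardRMatrix 𝔥 b E)))
      U
      (characteristicPair (fun _ => (⊥ : Submodule ℂ (Module.Dual ℂ 𝔥)).prod 𝔥.toSubmodule)
        (gaugeSection (Module.Dual ℂ 𝔥) τ)) := by
  set ρ := standardRMatrix 𝔥 b E with hρ
  have hρs : TensorProduct.comm ℂ 𝔤 𝔤 ρ = -ρ := comm_standardRMatrix b E
  refine ⟨isSubbundle_characteristicPair _ hU ?_, fun x hx => ?_, ?_⟩
  · have h := ((holomorphicOn_const (-ρ) U).add hr.holomorphic).linearMap_comp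
      (TensorProduct.map (LinearMap.inr ℂ (Module.Dual ℂ 𝔥) 𝔤)
        (LinearMap.inr ℂ (Module.Dual ℂ 𝔥) 𝔤))
    simp only [neg_add_cancel_left] at h
    exact h
  · refine maximal_isIsotropic_characteristicPair (comm_gaugeSection ?_)
    have h := hr.skew x hx
    rw [map_add, hρs] at h
    linear_combination (norm := module) h
  intro U' _ hU' e₁ e₂ he₁ he₂ x hx
  obtain ⟨hξ, hv₁, hm₁⟩ := mem_characteristicPair_gauge.1 (he₁.2 x hx)
  obtain ⟨hη, hv₂, hm₂⟩ := mem_characteristicPair_gauge.1 (he₂.2 x hx)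
  have hxU := hU' hx
  have hdefect := yangBaxterDefect_sub_mem b hE hr hxU hξ hη
  have hskew := hr.skew x hxU
  have hinv (h : 𝔤) (hh : h ∈ 𝔥) : ⁅h, ρ + τ x⁆ = 0 := hr.zero_weight x hxU ⟨h, hh⟩
  have habel (h k : 𝔤) (hh : h ∈ 𝔥) (hk : k ∈ 𝔥) : ⁅h, k⁆ = 0 :=
    congrArg Subtype.val (trivial_lie_zero 𝔥 𝔥 ⟨h, hh⟩ ⟨k, hk⟩)
  rw [mem_characteristicPair_gauge, courantBracket_gauge_fst hρs hv₁ hv₂,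
    courantBracket_gauge_snd hv₁ hv₂]
  rw [← hρ] at hdefect
  generalize (e₁ x).2 ∘ₗ LinearMap.inr ℂ (Module.Dual ℂ 𝔥) 𝔤 = ξ at *
  generalize (e₂ x).2 ∘ₗ LinearMap.inr ℂ (Module.Dual ℂ 𝔥) 𝔤 = η at *
  -- `h` and `k` are the `𝔥`-parts of the two sections at `x`.
  obtain ⟨h, hh⟩ : ∃ h, (e₁ x).1.2 = h + sharp (τ x) ξ := ⟨_, (sub_add_cancel _ _).symm⟩
  obtain ⟨k, hk⟩ : ∃ k, (e₂ x).1.2 = k + sharp (τ x) η := ⟨_, (sub_add_cancel _ _).symm⟩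
  rw [hh, add_sub_cancel_right] at hm₁
  rw [hk, add_sub_cancel_right] at hm₂
  rw [hh, hk]
  have hs (h : 𝔤) (ζ : Module.Dual ℂ 𝔤) :
      h + sharp (τ x) ζ + sharp ρ ζ = h + sharp (ρ + τ x) ζ := by
    rw [map_add, LinearMap.add_apply]; abel
  rw [hs, hs]
  refine ⟨fun c hc => ?_, rfl, ?_⟩
  · simp only [LinearMap.sub_apply, LinearMap.comp_apply, LieAlgebra.ad_apply, add_lie,
      habel _ c hm₁ hc, habel _ c hm₂ hc, zero_add]
    rw [apply_lie_sharp_of_invariant hskew (hinv c hc), sub_self]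
  · have hQ := yangBaxterDefect_eq_of_invariant (hinv h hm₁) (hinv k hm₂) (habel h k hm₁ hm₂) ξ η
    rw [← hQ] at hdefect
    -- What remains is the expansion of `r = ρ + τ`: the mixed terms in `ρ` and `τ` match, and the
    -- pure `ρ` terms are the subtracted defect.
    convert hdefect using 1
    have e : ⁅sharp ρ η, h + sharp (τ x) ξ⁆ = -⁅h + sharp (τ x) ξ, sharp ρ η⁆ :=
      (lie_skew _ _).symm
    simp only [yangBaxterDefect, map_add, map_sub, LinearMap.add_apply, LinearMap.comp_add, e,
      add_lie, lie_add]
    abel
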